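/- Let $(e_n)_{n\in\mathbb Z}$ be the canonical orthonormal basis of the complex Hilbert space $\ell^2(\mathbb Z)$. A bounded linear operator $T$ on $\ell^2(\mathbb Z)$ is a bilateral weighted shift if there are weights $w_n>0$ $(n\in\mathbb Z)$ with $Te_n=w_ne_{n+1}$ for all $n$, or $Te_n=w_ne_{n-1}$ for all $n$. For a vector $x$ put $\mathrm{Orb}(T,x)=\{T^nx:n\ge 0\}$. The operator $T$ is hypercyclic if $\mathrm{Orb}(T,x)$ is dense for some $x$; it is $M$-hypercyclic, for a closed subspace $M$, if $\mathrm{Orb}(T,x)\cap M$ is dense in $M$ for some $x\in\ell^2(\mathbb Z)$. Call $T$ a Salas shift if $T$ is a bilateral weighted shift such that both $T$ and its adjoint $T^*$ are hypercyclic. Then Salas shifts exist, and for every Salas shift $T$ both $T$ and $T^*$ are subspace-hypercyclic: there are closed subspaces $M_1,M_2$ of $\ell^2(\mathbb Z)$ (possibly different), each different from $\{0\}$ and from $\ell^2(\mathbb Z)$, such that $T$ is $M_1$-hypercyclic and $T^*$ is $M_2$-hypercyclic. In particular, Herrero's question (is there an operator such that both it and its adjoint are hypercyclic?) has a positive answer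 also for subspace-hypercyclicity. -/

import Mathlib

/-- The complex Hilbert space `ℓ²(ℤ)`. -/
abbrev EllTwoZ : Type := lp (fun _ : ℤ => ℂ) 2

/-- The canonical orthonormal basis vectors `e n` of `ℓ²(ℤ)`. -/
noncomputable def basisVec (n : ℤ) : EllTwoZ := lp.single 2 n (1 : ℂ)

section Hypercyclicity

variable {H : Type*} [NormedAddCommGroup H] [InnerProductSpace ℂ H]

/-- The orbit `{T ^ n x : n ≥ 0}` of `x` under the bounded linear operator `T`. -/
def orbit (T : H →L[ℂ] H) (x : H) : Set H := Set.range fun n : ℕ => (T ^ n) x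

/-- `T` is hypercyclic: some orbit of `T` is dense. -/
def IsHypercyclic (T : H →L[ℂ] H) : Prop := ∃ x : H, Dense (orbit T x)

/-- `T` is `M`-hypercyclic: for some `x` in the whole space, the set `orbit T x ∩ M` is dense
in `M`. -/
def IsHypercyclicFor (T : H →L[ℂ] H) (M : Submodule ℂ H) : Prop :=
  ∃ x : H, (M : Set H) ⊆ closure (orbit T x ∩ (M : Set H))

/-- `T` is subspace-hypercyclic: it is `M`-hypercyclic for a nontrivial closed subspace `M`,
that is, one different from `{0}` and from the whole space. -/
def IsSubspaceHypercyclic (T : H →L[ℂ] H) : Prop :=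
  ∃ M : Submodule ℂ H, IsClosed (M : Set H) ∧ M ≠ ⊥ ∧ M ≠ ⊤ ∧ IsHypercyclicFor T M

end Hypercyclicity

/-- `T` is a (forward or backward) bilateral weighted shift on `ℓ²(ℤ)` with positive weights `w`.
The weights are automatically bounded since `T` is. -/
def IsBilateralWeightedShift (T : EllTwoZ →L[ℂ] EllTwoZ) : Prop :=
  ∃ w : ℤ → ℝ, (∀ n, 0 < w n) ∧
    ((∀ n, T (basisVec n) = (w n : ℂ) • basisVec (n + 1)) ∨
      (∀ n, T (basisVec n) = (w n : ℂ) • basisVec (n - 1)))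

/-- `T` is a shift as in Salas's answer to Herrero's question: a bilateral weighted shift
such that both `T` and its Hilbert space adjoint are hypercyclic. -/
def IsSalasShift (T : EllTwoZ →L[ℂ] EllTwoZ) : Prop :=
  IsBilateralWeightedShift T ∧ IsHypercyclic T ∧ IsHypercyclic (ContinuousLinearMap.adjoint T)

/-! Subspace-hypercyclicity uses only that an orbit is dense: any dense set `A` is dense in some
nontrivial closed subspace. Choose `x n ∈ A` so that every `x i + q l • x j`, with `q` dense in `ℂ`,
is a limit of terms; then the closure `M` of the range is a subspace. To keep `M` proper, write each
`x n` as a combination of earlier terms plus `2⁻ⁿ • u n`, with `u n` near an orthonormal `g n ⊥ h`.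
All terms then lie in the span of `u`, whose closure misses `h`.

For existence, take weights `exp (s (n + 1) - s n)` with `s` even, 1-Lipschitz and unbounded above
and below. The `k`-th power sends `e n` to `exp (s (n + k) - s n) • e (n + k)`, so `s → -∞` along a
sequence gives the hypercyclicity criterion. The adjoint reverses the shift and replaces `s` by
`-s`. -/

open Filter Topology

/-! ### Dense sets and closed subspaces -/

section DenseSets

variable {H : Type*} [NormedAddCommGroup H] [InnerProductSpace ℂ H]

/-- The sequence with `x n = p n (x (i n) + c n • x (j n))` whenever `i n, j n < n`, and
`x n = p n 0` otherwise. -/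
noncomputable def combinationSeq (p : ℕ → H → H) (i j : ℕ → ℕ) (c : ℕ → ℂ) (n : ℕ) : H :=
  p n (if _h : i n < n ∧ j n < n then
    combinationSeq p i j c (i n) + c n • combinationSeq p i j c (j n) else 0)
termination_by n
decreasing_by
  · exact _h.1
  · exact _h.2

theorem exists_combinationSeq (P : ℕ → H → H → Prop) (hP : ∀ n y, ∃ x, P n y x)
    (i j : ℕ → ℕ) (c : ℕ → ℂ) :
    ∃ x : ℕ → H, ∀ n, P n (if i n < n ∧ j n < n then x (i n) + c n • x (j n) else 0) (x n) := by
  choose p hp using hP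
  refine ⟨combinationSeq p i j c, fun n => ?_⟩
  have h := hp n (if i n < n ∧ j n < n then
    combinationSeq p i j c (i n) + c n • combinationSeq p i j c (j n) else 0)
  have hx : combinationSeq p i j c n = p n (if i n < n ∧ j n < n then
      combinationSeq p i j c (i n) + c n • combinationSeq p i j c (j n) else 0) := by
    conv_lhs => rw [combinationSeq]
    simp only [dite_eq_ite]
  rw [← hx] at h
  exact h

/-- A unit vector orthogonal to an orthonormal sequence is far from the span of every small
perturbation of that sequence. -/
theorem norm_inner_le_of_mem_span_perturbation {g u : ℕ → H} {h : H} (hg : Orthonormal ℂ g)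
    (hh : ‖h‖ = 1) (hgh : ∀ n, inner ℂ h (g n) = 0)
    (hu : ∀ n, ‖u n - g n‖ ≤ (1 / 2 : ℝ) ^ n / 8) {v : H} (hv : v ∈ Submodule.span ℂ (Set.range u)) :
    ‖inner ℂ h v‖ ≤ ‖v‖ / 2 := by
  obtain ⟨c, rfl⟩ := (Finsupp.mem_span_range_iff_exists_finsupp).1 hv
  set v := c.sum fun i a => a • u i with hv'
  set w := c.sum fun i a => a • g i with hw
  have hc : ∀ n, ‖c n‖ ≤ ‖w‖ := by
    intro n
    have h1 : inner ℂ (g n) w = c n := by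
      have := hg.inner_right_finsupp c n
      rwa [Finsupp.linearCombination_apply] at this
    calc ‖c n‖ = ‖inner ℂ (g n) w‖ := by rw [h1]
      _ ≤ ‖g n‖ * ‖w‖ := norm_inner_le_norm _ _
      _ = ‖w‖ := by rw [hg.1 n, one_mul]
  have hvw : ‖v - w‖ ≤ ‖w‖ / 4 := by
    have h1 : v - w = ∑ n ∈ c.support, c n • (u n - g n) := by
      simp only [hv', hw, Finsupp.sum, smul_sub, Finset.sum_sub_distrib]
    rw [h1]
    calc ‖∑ n ∈ c.support, c n • (u n - g n)‖ ≤ ∑ n ∈ c.support, ‖c n • (u n - g n)‖ :=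
          norm_sum_le _ _
      _ ≤ ∑ n ∈ c.support, (‖w‖ / 8) * (1 / 2 : ℝ) ^ n := by
          refine Finset.sum_le_sum fun n _ => ?_
          rw [norm_smul]
          calc ‖c n‖ * ‖u n - g n‖ ≤ ‖w‖ * ((1 / 2 : ℝ) ^ n / 8) := by
                gcongr
                · exact hc n
                · exact hu n
            _ = _ := by ring
      _ = (‖w‖ / 8) * ∑ n ∈ c.support, (1 / 2 : ℝ) ^ n := by rw [Finset.mul_sum]
      _ ≤ (‖w‖ / 8) * 2 := by
          gcongr
          exact (summable_geometric_two.sum_le_tsum _ fun _ _ => by positivity).trans_eq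
            tsum_geometric_two
      _ = ‖w‖ / 4 := by ring
  have hhw : inner ℂ h w = 0 := by
    simp only [hw, Finsupp.sum, inner_sum, inner_smul_right, hgh, mul_zero, Finset.sum_const_zero]
  have h2 : ‖inner ℂ h v‖ ≤ ‖w‖ / 4 := by
    have : inner ℂ h v = inner ℂ h (v - w) := by rw [inner_sub_right, hhw, sub_zero]
    rw [this]
    calc _ ≤ ‖h‖ * ‖v - w‖ := norm_inner_le_norm _ _
      _ ≤ _ := by rw [hh, one_mul]; exact hvw
  have h3 : ‖w‖ ≤ ‖v‖ + ‖v - w‖ := by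
    have := norm_sub_le v (v - w)
    rwa [sub_sub_cancel] at this
  -- The bounds give `‖w‖ ≤ ‖v‖ + ‖w‖ / 4`, so the inner product is at most `‖v‖ / 3`.
  linarith [norm_nonneg w]

/-- If every `x i + q l • x j`, with `q` dense in the scalars, is a limit of terms of `x`, then the
closure of the range of `x` is closed under linear combinations. -/
theorem add_smul_mem_closure_range {x : ℕ → H} {q : ℕ → ℂ} (hq : DenseRange q)
    (hx : ∀ i j l, x i + q l • x j ∈ closure (Set.range x)) {a b : H} (c : ℂ)
    (ha : a ∈ closure (Set.range x)) (hb : b ∈ closure (Set.range x)) :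
    a + c • b ∈ closure (Set.range x) := by
  have hf : Continuous fun z : H × ℂ × H => z.1 + z.2.1 • z.2.2 := by fun_prop
  have hm : (a, c, b) ∈ closure (Set.range x ×ˢ Set.range q ×ˢ Set.range x) := by
    simp only [closure_prod_eq, Set.mem_prod]
    exact ⟨ha, hq c, hb⟩
  have := map_mem_closure (t := closure (Set.range x)) hf hm (by
    rintro ⟨_, _, _⟩ ⟨⟨i, rfl⟩, ⟨l, rfl⟩, ⟨j, rfl⟩⟩
    exact hx i j l)
  rwa [closure_closure] at this

/-- Every dense subset of an infinite-dimensional Hilbert space is dense in some nontrivial closed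
subspace. -/
theorem Dense.exists_submodule_subset_closure_inter {v : ℕ → H} (hv : Orthonormal ℂ v) {A : Set H}
    (hA : Dense A) :
    ∃ M : Submodule ℂ H, IsClosed (M : Set H) ∧ M ≠ ⊥ ∧ M ≠ ⊤ ∧
      (M : Set H) ⊆ closure (A ∩ (M : Set H)) := by
  set h := v 0 with hh
  set g : ℕ → H := fun n => v (n + 1) with hgdef
  have hg : Orthonormal ℂ g := hv.comp _ (add_left_injective 1)
  have hgh : ∀ n, inner ℂ h (g n) = 0 := fun n => hv.2 (by omega)
  let e := (Denumerable.eqv (ℕ × ℕ × ℕ × ℕ)).symm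
  let q := TopologicalSpace.denseSeq ℂ
  have hq : DenseRange q := TopologicalSpace.denseRange_denseSeq ℂ
  have hpick : ∀ (n : ℕ) (y : H), ∃ x, x ∈ A ∧ ∃ u : H, ‖u - g n‖ ≤ (1 / 2 : ℝ) ^ n / 8 ∧
      x = y + ((1 / 2 : ℂ) ^ n) • u := by
    intro n y
    -- The map `u ↦ y + 2⁻ⁿ • u` is a homeomorphism, so `u` can be taken arbitrarily close to `g n`
    -- whatever `y` is.
    have hd : Dense ((fun u : H => y + ((1 / 2 : ℂ) ^ n) • u) ⁻¹' A) := by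
      have hne : ((1 / 2 : ℂ) ^ n) ≠ 0 := pow_ne_zero _ (by norm_num)
      let E : H ≃ₜ H := (Homeomorph.smulOfNeZero _ hne).trans (Homeomorph.addLeft y)
      exact hA.preimage E.isOpenMap
    obtain ⟨u, hu, hdist⟩ := hd.exists_dist_lt (g n)
      (show (0 : ℝ) < (1 / 2 : ℝ) ^ n / 8 by positivity)
    refine ⟨_, hu, u, ?_, rfl⟩
    rw [← dist_eq_norm, dist_comm]
    exact hdist.le
  obtain ⟨x, hx⟩ := exists_combinationSeq _ hpick (fun n => (e n).1) (fun n => (e n).2.1)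
    (fun n => q (e n).2.2.1)
  have hxA : ∀ n, x n ∈ A := fun n => (hx n).1
  choose u hu hxu using fun n => (hx n).2
  have hsmall : Tendsto (fun n => ((1 / 2 : ℂ) ^ n) • u n) atTop (𝓝 0) := by
    refine squeeze_zero_norm (a := fun n => (1 / 2 : ℝ) ^ n * 2) (fun n => ?_) ?_
    · have h1 : ‖u n‖ ≤ ‖g n‖ + ‖u n - g n‖ := by
        have := norm_add_le (g n) (u n - g n)
        rwa [add_sub_cancel] at this
      have h2 : (1 / 2 : ℝ) ^ n ≤ 1 := pow_le_one₀ (by norm_num) (by norm_num)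
      have h3 := hu n
      rw [hg.1 n] at h1
      rw [norm_smul, norm_pow]
      have h4 : ‖(1 / 2 : ℂ)‖ = 1 / 2 := by norm_num
      rw [h4]
      gcongr
      linarith
    · have := (tendsto_pow_atTop_nhds_zero_of_lt_one (r := (1 / 2 : ℝ)) (by norm_num)
        (by norm_num)).mul_const 2
      simpa using this
  have hcomb : ∀ i j l, x i + q l • x j ∈ closure (Set.range x) := by
    intro i j l
    -- The fourth coordinate is padding: it makes every triple `(i, j, l)` recur at infinitely many
    -- indices.
    let N : ℕ → ℕ := fun m => e.symm (i, j, l, m)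
    have hN : Tendsto N atTop atTop := by
      refine Function.Injective.nat_tendsto_atTop fun m m' hm => ?_
      simpa using e.symm.injective hm
    refine mem_closure_of_tendsto (f := fun m => x (N m)) (b := atTop) ?_
      (Eventually.of_forall fun m => Set.mem_range_self _)
    have hlim : Tendsto (fun m => (x i + q l • x j) + ((1 / 2 : ℂ) ^ N m) • u (N m)) atTop
        (𝓝 (x i + q l • x j)) := by
      simpa using tendsto_const_nhds.add (hsmall.comp hN)
    refine hlim.congr' ?_
    filter_upwards [hN.eventually_gt_atTop i, hN.eventually_gt_atTop j] with m hi hj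
    have he : e (N m) = (i, j, l, m) := e.apply_symm_apply _
    rw [hxu (N m)]
    simp [he, hi, hj]
  have hspan : ∀ n, x n ∈ Submodule.span ℂ (Set.range u) := by
    intro n
    induction n using Nat.strong_induction_on with
    | _ n ih =>
      rw [hxu n]
      refine Submodule.add_mem _ ?_ (Submodule.smul_mem _ _ (Submodule.subset_span ⟨n, rfl⟩))
      split_ifs with hc
      · exact Submodule.add_mem _ (ih _ hc.1) (Submodule.smul_mem _ _ (ih _ hc.2))
      · exact Submodule.zero_mem _
  have hC := @add_smul_mem_closure_range H _ _ x q hq hcomb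
  have h0 : (0 : H) ∈ closure (Set.range x) := by
    have := hC (-1) (subset_closure ⟨0, rfl⟩) (subset_closure ⟨0, rfl⟩)
    simpa using this
  let M : Submodule ℂ H :=
    { carrier := closure (Set.range x)
      add_mem' := fun {a b} ha hb => by simpa using hC 1 ha hb
      zero_mem' := h0
      smul_mem' := fun c b hb => by simpa using hC c h0 hb }
  have hM : (M : Set H) = closure (Set.range x) := rfl
  refine ⟨M, by rw [hM]; exact isClosed_closure, ?_, ?_, ?_⟩
  -- At index 0 the guard fails, so `x 0 = u 0`, which is within `1 / 8` of a unit vector.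
  · intro hbot
    have hx0 : x 0 ∈ M := subset_closure ⟨0, rfl⟩
    rw [hbot, Submodule.mem_bot, hxu 0] at hx0
    have h1 := hu 0
    simp only [not_lt_zero, and_self, if_false, pow_zero, one_smul, zero_add] at hx0
    rw [hx0, zero_sub, norm_neg, hg.1 0] at h1
    norm_num at h1
  -- The estimate on the span of `u` passes to the closure; at `h` it would read `1 ≤ 1 / 2`.
  · intro htop
    have hmem : h ∈ closure (Set.range x) := by
      have : h ∈ M := htop ▸ Submodule.mem_top
      exact this
    have hcl : closure (Set.range x) ⊆ {y : H | ‖inner ℂ h y‖ ≤ ‖y‖ / 2} := by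
      refine closure_minimal ?_ (isClosed_le (by fun_prop) (by fun_prop))
      rintro _ ⟨n, rfl⟩
      exact norm_inner_le_of_mem_span_perturbation hg (hv.1 0) hgh hu (hspan n)
    have h1 : ‖inner ℂ h h‖ ≤ ‖h‖ / 2 := hcl hmem
    rw [inner_self_eq_norm_sq_to_K, hh, hv.1 0] at h1
    norm_num at h1
  · rw [hM]
    refine closure_mono ?_
    rintro _ ⟨n, rfl⟩
    exact ⟨hxA n, subset_closure ⟨n, rfl⟩⟩

theorem IsHypercyclic.isSubspaceHypercyclic {v : ℕ → H} (hv : Orthonormal ℂ v) {T : H →L[ℂ] H}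
    (hT : IsHypercyclic T) : IsSubspaceHypercyclic T := by
  obtain ⟨x, hx⟩ := hT
  obtain ⟨M, hMc, hbot, htop, hM⟩ := hx.exists_submodule_subset_closure_inter hv
  exact ⟨M, hMc, hbot, htop, x, hM⟩

end DenseSets

/-! ### The hypercyclicity criterion -/

section Criterion

variable {H : Type*} [NormedAddCommGroup H] [InnerProductSpace ℂ H]

/-- Vectors whose images under a sequence of operators tend to zero form a dense set as soon as
they contain a set with dense span. -/
theorem dense_setOf_tendsto_zero {A : ℕ → H →L[ℂ] H} {D : Set H}
    (hD : Dense (Submodule.span ℂ D : Set H))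
    (h : ∀ d ∈ D, Tendsto (fun i => A i d) atTop (𝓝 0)) :
    Dense {x : H | Tendsto (fun i => A i x) atTop (𝓝 0)} := by
  refine hD.mono fun x hx => ?_
  induction hx using Submodule.span_induction with
  | mem d hd => exact h d hd
  | zero => simp
  | add x y _ _ hx hy =>
    have := Tendsto.add hx hy
    simpa using this
  | smul c x _ hx =>
    have := Tendsto.const_smul hx c
    simpa using this

/-- The hypercyclicity criterion for an operator with a bounded right inverse. -/
theorem isHypercyclic_of_tendsto_zero [CompleteSpace H] [SecondCountableTopology H]
    {T S : H →L[ℂ] H} (hTS : T * S = 1) {D : Set H}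
    (hD : Dense (Submodule.span ℂ D : Set H)) (n : ℕ → ℕ)
    (hT : ∀ d ∈ D, Tendsto (fun i => (T ^ n i) d) atTop (𝓝 0))
    (hS : ∀ d ∈ D, Tendsto (fun i => (S ^ n i) d) atTop (𝓝 0)) : IsHypercyclic T := by
  have hpow : ∀ (k : ℕ) (y : H), (T ^ k) ((S ^ k) y) = y := by
    intro k y
    have h1 : T ^ k * S ^ k = 1 := by
      induction k with
      | zero => simp
      | succ k ih =>
        calc T ^ (k + 1) * S ^ (k + 1) = T ^ k * (T * S) * S ^ k := by
              rw [pow_succ, pow_succ']; simp only [mul_assoc]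
          _ = 1 := by rw [hTS, mul_one, ih]
    simpa using congrArg (fun A : H →L[ℂ] H => A y) h1
  -- Topological transitivity: `x + S ^ n i y` tends to `x`, while its image `T ^ n i x + y` tends
  -- to `y`. Baire's theorem then yields a dense orbit.
  have htrans : ∀ V : Set H, IsOpen V → V.Nonempty → Dense (⋃ k : ℕ, (T ^ k) ⁻¹' V) := by
    intro V hV hVne
    rw [dense_iff_inter_open]
    intro U hU hUne
    obtain ⟨x, hxU, hx⟩ := (dense_setOf_tendsto_zero hD hT).inter_open_nonempty U hU hUne
    obtain ⟨y, hyV, hy⟩ := (dense_setOf_tendsto_zero hD hS).inter_open_nonempty V hV hVne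
    have h1 : Tendsto (fun i => x + (S ^ n i) y) atTop (𝓝 x) := by
      simpa using tendsto_const_nhds.add hy
    have h2 : Tendsto (fun i => (T ^ n i) (x + (S ^ n i) y)) atTop (𝓝 y) := by
      simp only [map_add, hpow]
      simpa using Tendsto.add_const y hx
    obtain ⟨i, hi1, hi2⟩ :=
      ((h1.eventually (hU.mem_nhds hxU)).and (h2.eventually (hV.mem_nhds hyV))).exists
    exact ⟨_, hi1, Set.mem_iUnion.2 ⟨n i, hi2⟩⟩
  let B := TopologicalSpace.countableBasis H
  have hB := TopologicalSpace.isBasis_countableBasis H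
  have hdense : Dense (⋂ V : B, ⋃ k : ℕ, (T ^ k) ⁻¹' (V : Set H)) := by
    refine dense_iInter_of_isOpen (fun V => ?_) (fun V => ?_)
    · exact isOpen_iUnion fun k => (TopologicalSpace.isOpen_of_mem_countableBasis V.2).preimage
        (T ^ k).continuous
    · exact htrans V (TopologicalSpace.isOpen_of_mem_countableBasis V.2)
        (TopologicalSpace.nonempty_of_mem_countableBasis V.2)
  obtain ⟨x, hx⟩ := hdense.nonempty
  refine ⟨x, hB.dense_iff.2 fun V hV _ => ?_⟩
  obtain ⟨k, hk⟩ := Set.mem_iUnion.1 (Set.mem_iInter.1 hx ⟨V, hV⟩)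
  exact ⟨_, hk, k, rfl⟩

end Criterion

/-! ### Weighted shifts given by a potential -/

section Shifts

theorem orthonormal_basisVec : Orthonormal ℂ basisVec := by
  classical
  let b : HilbertBasis ℤ ℂ EllTwoZ := HilbertBasis.ofRepr (LinearIsometryEquiv.refl ℂ EllTwoZ)
  have hb : ⇑b = basisVec := by
    funext n
    rw [← b.repr_symm_single n]
    rfl
  exact hb ▸ b.orthonormal

theorem dense_span_basisVec : Dense (Submodule.span ℂ (Set.range basisVec) : Set EllTwoZ) := by
  classical
  let b : HilbertBasis ℤ ℂ EllTwoZ := HilbertBasis.ofRepr (LinearIsometryEquiv.refl ℂ EllTwoZ)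
  have hb : ⇑b = basisVec := by
    funext n
    rw [← b.repr_symm_single n]
    rfl
  rw [Submodule.dense_iff_topologicalClosure_eq_top]
  exact hb ▸ b.dense_span

instance secondCountableTopology_ellTwoZ : SecondCountableTopology EllTwoZ := by
  have h : TopologicalSpace.IsSeparable
      (closure (Submodule.span ℂ (Set.range basisVec) : Set EllTwoZ)) :=
    ((Set.countable_range basisVec).isSeparable.span (R := ℂ)).closure
  rw [dense_span_basisVec.closure_eq] at h
  have : TopologicalSpace.SeparableSpace EllTwoZ := TopologicalSpace.isSeparable_univ_iff.1 h
  exact UniformSpace.secondCountable_of_separable EllTwoZ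

theorem LipschitzWith.sub_shift_le {s : ℤ → ℝ} (hs : LipschitzWith 1 s) (d n : ℤ) :
    s n - s (n - d) ≤ |(d : ℝ)| := by
  have h := hs.dist_le_mul n (n - d)
  rw [Real.dist_eq, Int.dist_eq] at h
  simp only [NNReal.coe_one, one_mul, Int.cast_sub, sub_sub_cancel] at h
  exact (le_abs_self _).trans h

/-- The shift by `d` weighted by the potential `s`, sending `e n` to
`exp (s (n + d) - s n) • e (n + d)`. -/
noncomputable def potentialShift (s : ℤ → ℝ) (hs : LipschitzWith 1 s) (d : ℤ) :
    EllTwoZ →L[ℂ] EllTwoZ :=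
  have hbound : ∀ (x : EllTwoZ) (n : ℤ), ‖(Real.exp (s n - s (n - d)) : ℂ) * x (n - d)‖ ^ 2 ≤
      Real.exp |(d : ℝ)| ^ 2 * ‖x (n - d)‖ ^ 2 := fun x n => by
    rw [norm_mul, mul_pow, Complex.norm_real, Real.norm_eq_abs, Real.abs_exp]
    gcongr
    exact hs.sub_shift_le d n
  have hsum : ∀ x : EllTwoZ, HasSum (fun n => Real.exp |(d : ℝ)| ^ 2 * ‖x (n - d)‖ ^ 2)
      (Real.exp |(d : ℝ)| ^ 2 * ‖x‖ ^ 2) := fun x => by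
    have h1 := lp.hasSum_norm (p := 2) (by norm_num) x
    simp only [ENNReal.toReal_ofNat, Real.rpow_ofNat] at h1
    exact ((Equiv.subRight d).hasSum_iff.2 h1).mul_left _
  have hmem : ∀ x : EllTwoZ,
      Memℓp (fun n : ℤ => (Real.exp (s n - s (n - d)) : ℂ) * x (n - d)) 2 := fun x => by
    refine memℓp_gen ?_
    simp only [ENNReal.toReal_ofNat, Real.rpow_ofNat]
    exact Summable.of_nonneg_of_le (fun _ => by positivity) (hbound x) (hsum x).summable
  LinearMap.mkContinuous
    { toFun := fun x => ⟨fun n : ℤ => (Real.exp (s n - s (n - d)) : ℂ) * x (n - d), hmem x⟩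
      map_add' := fun x y => by
        ext n
        simp only [lp.coeFn_add, Pi.add_apply, mul_add]
      map_smul' := fun c x => by
        ext n
        simp only [lp.coeFn_smul, Pi.smul_apply, smul_eq_mul, RingHom.id_apply]
        ring }
    (Real.exp |(d : ℝ)|) (fun x => by
      refine lp.norm_le_of_tsum_le (p := 2) (by norm_num) (by positivity) ?_
      simp only [ENNReal.toReal_ofNat, Real.rpow_ofNat, mul_pow]
      rw [← (hsum x).tsum_eq]
      exact Summable.tsum_le_tsum (hbound x)
        (Summable.of_nonneg_of_le (fun _ => by positivity) (hbound x) (hsum x).summable)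
        (hsum x).summable)

theorem potentialShift_apply (s : ℤ → ℝ) (hs : LipschitzWith 1 s) (d : ℤ) (x : EllTwoZ) (n : ℤ) :
    potentialShift s hs d x n = (Real.exp (s n - s (n - d)) : ℂ) * x (n - d) := rfl

theorem potentialShift_basisVec (s : ℤ → ℝ) (hs : LipschitzWith 1 s) (d n : ℤ) :
    potentialShift s hs d (basisVec n) =
      ((Real.exp (s (n + d) - s n) : ℝ) : ℂ) • basisVec (n + d) := by
  ext m
  rw [potentialShift_apply, lp.coeFn_smul, Pi.smul_apply, smul_eq_mul, basisVec, basisVec,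
    lp.single_apply, lp.single_apply]
  by_cases h : m = n + d
  · subst h
    simp
  · rw [Pi.single_eq_of_ne h, Pi.single_eq_of_ne (by omega), mul_zero, mul_zero]

theorem potentialShift_zero (s : ℤ → ℝ) (hs : LipschitzWith 1 s) :
    potentialShift s hs 0 = 1 := by
  ext x n
  simp [potentialShift_apply]

theorem potentialShift_mul (s : ℤ → ℝ) (hs : LipschitzWith 1 s) (d d' : ℤ) :
    potentialShift s hs d * potentialShift s hs d' = potentialShift s hs (d + d') := by
  ext x n
  rw [mul_apply_eq_comp, potentialShift_apply, potentialShift_apply,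
    potentialShift_apply, ← mul_assoc, ← Complex.ofReal_mul, ← Real.exp_add, sub_sub,
    sub_add_sub_cancel]

theorem potentialShift_pow (s : ℤ → ℝ) (hs : LipschitzWith 1 s) (d : ℤ) (k : ℕ) :
    potentialShift s hs d ^ k = potentialShift s hs (k * d) := by
  induction k with
  | zero => simp [potentialShift_zero]
  | succ k ih =>
    rw [pow_succ, ih, potentialShift_mul]
    congr 1
    push_cast
    ring

theorem adjoint_potentialShift (s : ℤ → ℝ) (hs : LipschitzWith 1 s)
    (hs' : LipschitzWith 1 fun n => -s n) (d : ℤ) :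
    ContinuousLinearMap.adjoint (potentialShift s hs d) =
      potentialShift (fun n => -s n) hs' (-d) := by
  symm
  rw [ContinuousLinearMap.eq_adjoint_iff]
  intro x y
  rw [lp.inner_eq_tsum, lp.inner_eq_tsum, ← (Equiv.subRight d).tsum_eq]
  refine tsum_congr fun n => ?_
  simp only [Equiv.subRight_apply, potentialShift_apply, RCLike.inner_apply, map_mul,
    Complex.conj_ofReal, sub_neg_eq_add, sub_add_cancel]
  rw [show -s (n - d) + s n = s n - s (n - d) by ring]
  ring

/-- The Lipschitz bound gives `s (n + k) ≤ s k + |n|`, so decay at one basis vector forces decay at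
all of them. -/
theorem tendsto_potentialShift_basisVec {s : ℤ → ℝ} (hs : LipschitzWith 1 s) {k : ℕ → ℤ}
    (hk : Tendsto (fun i => s (k i)) atTop atBot) (n : ℤ) :
    Tendsto (fun i => potentialShift s hs (k i) (basisVec n)) atTop (𝓝 0) := by
  refine squeeze_zero_norm (a := fun i => Real.exp (s (k i) + (|(n : ℝ)| - s n))) (fun i => ?_)
    (Real.tendsto_exp_atBot.comp (tendsto_atBot_add_const_right _ _ hk))
  rw [potentialShift_basisVec, norm_smul, orthonormal_basisVec.1, mul_one, Complex.norm_real,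
    Real.norm_eq_abs, Real.abs_exp, Real.exp_le_exp]
  have h := hs.sub_shift_le n (n + k i)
  rw [add_sub_cancel_left] at h
  linarith

/-- The inverse is the shift by `-d`. Evenness of `s` lets one sequence `k` serve the powers of
both. -/
theorem isHypercyclic_potentialShift {s : ℤ → ℝ} (hs : LipschitzWith 1 s)
    (heven : ∀ n, s (-n) = s n) {k : ℕ → ℕ} (hk : Tendsto (fun i => s (k i)) atTop atBot)
    {d : ℤ} (hd : d = 1 ∨ d = -1) : IsHypercyclic (potentialShift s hs d) := by
  have hlim : ∀ c : ℤ, (c = 1 ∨ c = -1) → ∀ e ∈ Set.range basisVec,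
      Tendsto (fun i => (potentialShift s hs c ^ k i) e) atTop (𝓝 0) := by
    rintro c hc _ ⟨n, rfl⟩
    simp only [potentialShift_pow]
    refine tendsto_potentialShift_basisVec hs ?_ n
    rcases hc with rfl | rfl
    · simpa using hk
    · simpa [heven] using hk
  refine isHypercyclic_of_tendsto_zero (S := potentialShift s hs (-d)) ?_ dense_span_basisVec k
    (hlim d hd) (hlim (-d) (by omega))
  rw [potentialShift_mul, add_neg_cancel, potentialShift_zero]

end Shifts

/-! ### An oscillating Lipschitz potential -/

section Oscillation

/-- Splitting the difference gives the bound `(√x - √y) * (1 + √y)`; since `1 ≤ √x`, this is at most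
`(√x - √y) * (√x + √y) = x - y`. -/
theorem abs_sqrt_mul_sin_sqrt_sub_le {x y : ℝ} (hy : 0 ≤ y) (hyx : y ≤ x) (hx : 1 ≤ x) :
    |√x * Real.sin √x - √y * Real.sin √y| ≤ x - y := by
  have ha : 1 ≤ √x := Real.one_le_sqrt.2 hx
  have hb : 0 ≤ √y := Real.sqrt_nonneg y
  have hab : √y ≤ √x := Real.sqrt_le_sqrt hyx
  have h1 : |Real.sin √x - Real.sin √y| ≤ √x - √y := by
    have := Real.abs_sin_sub_sin_le √x √y
    rwa [abs_of_nonneg (sub_nonneg.2 hab)] at this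
  have h2 : √x * Real.sin √x - √y * Real.sin √y =
      (√x - √y) * Real.sin √x + √y * (Real.sin √x - Real.sin √y) := by ring
  calc |√x * Real.sin √x - √y * Real.sin √y|
      ≤ |(√x - √y) * Real.sin √x| + |√y * (Real.sin √x - Real.sin √y)| := by
        rw [h2]; exact abs_add_le _ _
    _ ≤ (√x - √y) * 1 + √y * (√x - √y) := by
        rw [abs_mul, abs_mul, abs_of_nonneg hb, abs_of_nonneg (sub_nonneg.2 hab)]
        gcongr
        exact Real.abs_sin_le_one _
    _ ≤ (√x - √y) * (√x + √y) := by nlinarith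
    _ = x - y := by
        rw [mul_comm, ← sq_sub_sq, Real.sq_sqrt (by linarith), Real.sq_sqrt hy]

/-- An even potential on `ℤ` with slopes at most one that is unbounded above and below. -/
noncomputable def sqrtOscillation (n : ℤ) : ℝ := √|(n : ℝ)| * Real.sin √|(n : ℝ)|

theorem sqrtOscillation_neg (n : ℤ) : sqrtOscillation (-n) = sqrtOscillation n := by
  simp [sqrtOscillation]

theorem lipschitzWith_sqrtOscillation : LipschitzWith 1 sqrtOscillation := by
  have key : ∀ m n : ℤ, |n| ≤ |m| → |sqrtOscillation m - sqrtOscillation n| ≤ |(m : ℝ) - n| := by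
    intro m n h
    -- The real estimate needs the larger argument to be at least 1, which for integers excludes
    -- only 0.
    rcases eq_or_ne m 0 with rfl | hm
    · have : n = 0 := by simpa using h
      simp [this]
    · have h1 : (1 : ℝ) ≤ |(m : ℝ)| := by exact_mod_cast Int.one_le_abs hm
      have h2 : |(n : ℝ)| ≤ |(m : ℝ)| := by exact_mod_cast h
      exact (abs_sqrt_mul_sin_sqrt_sub_le (abs_nonneg _) h2 h1).trans (abs_sub_abs_le_abs_sub _ _)
  refine LipschitzWith.of_dist_le_mul fun m n => ?_
  rw [Real.dist_eq, Int.dist_eq, NNReal.coe_one, one_mul]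
  rcases le_total |n| |m| with h | h
  · exact key m n h
  · rw [abs_sub_comm, abs_sub_comm (m : ℝ)]
    exact key n m h

/-- Rounding `a ^ 2` down moves the argument by less than 1, so the slope bound controls the error.
-/
theorem abs_sqrtOscillation_floor_sq_sub_le {a : ℝ} (ha : 1 ≤ a) :
    |sqrtOscillation (⌊a ^ 2⌋₊ : ℤ) - a * Real.sin a| ≤ 1 := by
  have h0 : (0 : ℝ) ≤ a ^ 2 := sq_nonneg a
  have h := abs_sqrt_mul_sin_sqrt_sub_le (Nat.cast_nonneg ⌊a ^ 2⌋₊) (Nat.floor_le h0)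
    (one_le_pow₀ ha)
  rw [Real.sqrt_sq (by linarith)] at h
  rw [abs_sub_comm]
  simp only [sqrtOscillation, Int.cast_natCast, Nat.abs_cast]
  linarith [Nat.lt_floor_add_one (a ^ 2)]

theorem exists_tendsto_sqrtOscillation_atTop :
    ∃ k : ℕ → ℕ, Tendsto (fun i => sqrtOscillation (k i)) atTop atTop := by
  -- Here the sine equals 1, so the potential is at least `a - 1`, which exceeds `i`.
  refine ⟨fun i => ⌊(Real.pi / 2 + i * (2 * Real.pi)) ^ 2⌋₊, ?_⟩
  refine tendsto_atTop_mono (f := fun i : ℕ => (i : ℝ)) (fun i => ?_) tendsto_natCast_atTop_atTop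
  have hpi := Real.pi_gt_three
  have hi : (0 : ℝ) ≤ i := Nat.cast_nonneg i
  have h := abs_sqrtOscillation_floor_sq_sub_le (a := Real.pi / 2 + i * (2 * Real.pi)) (by nlinarith)
  rw [Real.sin_add_nat_mul_two_pi, Real.sin_pi_div_two, mul_one, abs_le] at h
  nlinarith [h.1]

theorem exists_tendsto_sqrtOscillation_atBot :
    ∃ k : ℕ → ℕ, Tendsto (fun i => sqrtOscillation (k i)) atTop atBot := by
  -- Here the sine equals `-1`.
  refine ⟨fun i => ⌊(Real.pi / 2 + Real.pi + i * (2 * Real.pi)) ^ 2⌋₊, ?_⟩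
  have hneg : Tendsto (fun i : ℕ => -(i : ℝ)) atTop atBot :=
    tendsto_neg_atTop_atBot.comp tendsto_natCast_atTop_atTop
  refine tendsto_atBot_mono (fun i => ?_) hneg
  have hpi := Real.pi_gt_three
  have hi : (0 : ℝ) ≤ i := Nat.cast_nonneg i
  have h := abs_sqrtOscillation_floor_sq_sub_le
    (a := Real.pi / 2 + Real.pi + i * (2 * Real.pi)) (by nlinarith)
  rw [Real.sin_add_nat_mul_two_pi, Real.sin_add_pi, Real.sin_pi_div_two, abs_le] at h
  nlinarith [h.2]

end Oscillation

/-! ### Salas shifts and the main theorem -/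

theorem exists_isSalasShift : ∃ T : EllTwoZ →L[ℂ] EllTwoZ, IsSalasShift T := by
  have hneg : LipschitzWith 1 fun n => -sqrtOscillation n := lipschitzWith_sqrtOscillation.neg
  obtain ⟨k, hk⟩ := exists_tendsto_sqrtOscillation_atBot
  obtain ⟨l, hl⟩ := exists_tendsto_sqrtOscillation_atTop
  refine ⟨potentialShift sqrtOscillation lipschitzWith_sqrtOscillation 1,
    ⟨fun n => Real.exp (sqrtOscillation (n + 1) - sqrtOscillation n), fun n => Real.exp_pos _,
      Or.inl fun n => potentialShift_basisVec _ _ 1 n⟩,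
    isHypercyclic_potentialShift _ sqrtOscillation_neg hk (Or.inl rfl), ?_⟩
  rw [adjoint_potentialShift _ _ hneg]
  exact isHypercyclic_potentialShift hneg (fun n => by rw [sqrtOscillation_neg])
    (tendsto_neg_atTop_atBot.comp hl) (Or.inr rfl)

theorem mainTheorem6 :
    (∃ T : EllTwoZ →L[ℂ] EllTwoZ, IsSalasShift T) ∧
      ∀ T : EllTwoZ →L[ℂ] EllTwoZ, IsSalasShift T →
        IsSubspaceHypercyclic T ∧ IsSubspaceHypercyclic (ContinuousLinearMap.adjoint T) := by
  have hv : Orthonormal ℂ fun n : ℕ => basisVec n :=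
    orthonormal_basisVec.comp _ Nat.cast_injective
  exact ⟨exists_isSalasShift, fun T hT =>
    ⟨hT.2.1.isSubspaceHypercyclic hv, hT.2.2.isSubspaceHypercyclic hv⟩⟩
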